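/- Let $d\ge 1$ and let $g:\mathbb{R}^d\to[0,1]$ be a connection function, i.e. $g(x)$ depends only on $\|x\|$ and $g(x)\ge g(y)$ whenever $\|x\|\le\|y\|$ (Euclidean norm). Suppose that $0<\int_{\mathbb{R}^d} g(x)\,\mathrm{d}x<\infty$. Let $\lambda>0$ and let $\eta$ be a homogeneous Poisson point process on $\mathbb{R}^d$ of intensity $\lambda$; write $\eta^{\mathbf 0}=\eta\cup\{\mathbf 0\}$. To every unordered pair of distinct points $x,y\in\eta^{\mathbf 0}$ attach a uniform random variable $U_{x,y}$ on $[0,1]$, these variables being independent of each other and of $\eta$. For a connection function $f$ let $G_f(\eta^{\mathbf 0})$ be the graph with vertex set $\eta^{\mathbf 0}$ in which distinct $x,y$ are adjacent if and only if $U_{x,y}\le f(x-y)$. For $R>0$ let $g^R(x)=g(x)\mathbf 1(\|x\|\le R)$, and let $\mathcal C_0$ and $\mathcal C_0^R$ be the vertex sets of the connected components of $\mathbf 0$ in $G_g(\eta^{\mathbf 0})$ and in $G_{g^R}(\eta^{\mathbf 0})$ respectively, both graphs being built from the same $\eta$ and the same variables $U_{x,y}$. Then, for every $k\in\mathbb{N}$,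 $$\mathbb{P}\bigl[\,|\mathcal C_0^R|=k\ \text{ and }\ \mathcal C_0\neq\mathcal C_0^R\,\bigr]\longrightarrow 0\qquad\text{as } R\to\infty .$$ -/

import Mathlib

open MeasureTheory ProbabilityTheory Filter Topology
open scoped NNReal ENNReal

/-- A connection function on `ℝ^d`: a function with values in `[0,1]` such that `g x` depends only
on `‖x‖` and `g x ≥ g y` whenever `‖x‖ ≤ ‖y‖`. -/
structure ConnectionFunction (d : ℕ) where
  toFun : EuclideanSpace ℝ (Fin d) → ℝ
  nonneg : ∀ x, 0 ≤ toFun x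
  le_one : ∀ x, toFun x ≤ 1
  radial : ∀ x y, ‖x‖ = ‖y‖ → toFun x = toFun y
  antitone : ∀ x y, ‖x‖ ≤ ‖y‖ → toFun y ≤ toFun x

namespace ConnectionFunction

variable {d : ℕ}

open Classical in
/-- The cut-off connection function `g^R(x) = g(x) 1(‖x‖ ≤ R)`. -/
noncomputable def cutoff (g : ConnectionFunction d) (R : ℝ) : ConnectionFunction d where
  toFun x := if ‖x‖ ≤ R then g.toFun x else 0
  nonneg x := by
    by_cases h : ‖x‖ ≤ R
    · rw [if_pos h]; exact g.nonneg x
    · rw [if_neg h]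
  le_one x := by
    by_cases h : ‖x‖ ≤ R
    · rw [if_pos h]; exact g.le_one x
    · rw [if_neg h]; exact zero_le_one
  radial x y hxy := by rw [hxy, g.radial x y hxy]
  antitone x y hxy := by
    by_cases h : ‖y‖ ≤ R
    · rw [if_pos h, if_pos (hxy.trans h)]; exact g.antitone x y hxy
    · rw [if_neg h]
      by_cases h' : ‖x‖ ≤ R
      · rw [if_pos h']; exact g.nonneg x
      · rw [if_neg h']

/-- The graph `G_g(S)` on the vertex set `S ⊆ ℝ^d`, built from marks `u` attached to the unordered
pairs of points: distinct `x, y ∈ S` are adjacent if and only if `u {x, y} ≤ g (x - y)`. -/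
def graph (g : ConnectionFunction d) (S : Set (EuclideanSpace ℝ (Fin d)))
    (u : Sym2 (EuclideanSpace ℝ (Fin d)) → ℝ) : SimpleGraph S where
  Adj x y := x ≠ y ∧ u s(x.1, y.1) ≤ g.toFun (x.1 - y.1)
  symm := ⟨fun x y h => ⟨h.1.symm, by
    rw [Sym2.eq_swap, g.radial _ _ (norm_sub_rev y.1 x.1)]; exact h.2⟩⟩
  loopless := ⟨fun _ h => h.1 rfl⟩

/-- The connected component of the origin in `G_g(S ∪ {0})`, as a set of vertices. -/
def originCluster (g : ConnectionFunction d) (S : Set (EuclideanSpace ℝ (Fin d)))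
    (u : Sym2 (EuclideanSpace ℝ (Fin d)) → ℝ) :
    Set ↥(insert (0 : EuclideanSpace ℝ (Fin d)) S) :=
  ((g.graph (insert 0 S) u).connectedComponentMk ⟨0, Set.mem_insert 0 S⟩).supp

end ConnectionFunction

/-- The random set of points `η` is a homogeneous Poisson point process on `ℝ^d` of intensity `lam`:
the number of points in a Borel set `B` of finite volume has law Poisson(`lam * |B|`), and the
numbers of points in pairwise disjoint Borel sets are independent. -/
structure IsPoissonPointProcess {d : ℕ} {Ω : Type*} [MeasurableSpace Ω] (P : Measure Ω)
    (lam : ℝ≥0) (η : Ω → Set (EuclideanSpace ℝ (Fin d))) : Prop where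
  hasLaw_count : ∀ B : Set (EuclideanSpace ℝ (Fin d)), MeasurableSet B → volume B < ∞ →
    HasLaw (fun ω => (η ω ∩ B).encard)
      ((poissonMeasure (lam * (volume B).toNNReal)).map (Nat.cast : ℕ → ℕ∞)) P
  indep_count : ∀ (n : ℕ) (B : Fin n → Set (EuclideanSpace ℝ (Fin d))),
    (∀ i, MeasurableSet (B i)) → Pairwise (fun i j => Disjoint (B i) (B j)) →
    iIndepFun (fun i ω => (η ω ∩ B i).encard) P

/-- The vertices of `η ∪ {0}` when `η` is enumerated as `x 0, x 1, …`: the label `none` stands for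
the added origin and the label `some i` for the point `x i`. -/
def withOrigin {d : ℕ} (x : ℕ → EuclideanSpace ℝ (Fin d)) : Option ℕ → EuclideanSpace ℝ (Fin d)
  | none => 0
  | some i => x i

/-- The joint law `ℙ_{λ,g}` of a Poisson point process `η` of intensity `lam` on `ℝ^d` and of the
marks `U ω {x, y}` on the unordered pairs of distinct points of `η ω ∪ {0}`: the marks are
independent, uniform on `[0,1]`, and independent of the points. As the points are random, this is
expressed through a measurable enumeration `X 0, X 1, …` of `η` without repetition (which is almost
surely infinite when `lam > 0` and `d ≥ 1`). -/
structure IsMarkedPoisson {d : ℕ} {Ω : Type*} [MeasurableSpace Ω] (P : Measure Ω)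
    (lam : ℝ≥0) (η : Ω → Set (EuclideanSpace ℝ (Fin d)))
    (U : Ω → Sym2 (EuclideanSpace ℝ (Fin d)) → ℝ) : Prop where
  poisson : IsPoissonPointProcess P lam η
  marks : ∃ X : Ω → ℕ → EuclideanSpace ℝ (Fin d),
    Measurable X ∧
    (∀ᵐ ω ∂P, Function.Injective (X ω) ∧ Set.range (X ω) = η ω) ∧
    (∀ e : {e : Sym2 (Option ℕ) // ¬ e.IsDiag},
      HasLaw (fun ω => U ω (e.1.map (withOrigin (X ω))))
        ((volume : Measure ℝ).restrict (Set.Icc 0 1)) P) ∧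
    iIndepFun (fun (e : {e : Sym2 (Option ℕ) // ¬ e.IsDiag}) ω =>
      U ω (e.1.map (withOrigin (X ω)))) P ∧
    IndepFun (fun ω (e : {e : Sym2 (Option ℕ) // ¬ e.IsDiag}) =>
      U ω (e.1.map (withOrigin (X ω)))) X P

/-! ### Exhausting a graph by subgraphs; measurability of components -/

namespace SimpleGraph

/-! The convergence is pathwise. Fix a realisation: each edge of the full graph survives the cutoff
once `R` exceeds its length, and a path has finitely many edges, so any finite part of the full
cluster eventually lies in the truncated one. A finite cluster is thus eventually recovered exactly,
and an infinite one eventually forces more than `k` vertices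
(`eventually_not_encard_supp_eq_and_ne`). Hence the indicators of the events tend to `0` everywhere,
and so do the probabilities. The remaining work is measurability: the graphs are moved to the fixed
countable label set `Option ℕ` by `originCluster_eq_image_supp`, where components are measurable by
`measurable_supp`. -/

theorem eventually_reachable {V ι : Type*} {G : SimpleGraph V} {H : ι → SimpleGraph V}
    {l : Filter ι} (hlim : ∀ x y, G.Adj x y → ∀ᶠ i in l, (H i).Adj x y) {v w : V}
    (h : G.Reachable v w) : ∀ᶠ i in l, (H i).Reachable v w := by
  rw [reachable_iff_reflTransGen] at h
  induction h with
  | refl => exact Eventually.of_forall fun _ => Reachable.refl _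
  | tail _ hadj ih =>
    filter_upwards [ih, hlim _ _ hadj] with i h₁ h₂ using h₁.trans h₂.reachable

/-- If the graphs `H i ≤ G` exhaust the edges of `G`, then eventually the component of `v` in `H i`
does not have exactly `k` vertices, or it is the whole component of `v` in `G`. -/
theorem eventually_not_encard_supp_eq_and_ne {V ι : Type*} {G : SimpleGraph V}
    {H : ι → SimpleGraph V} {l : Filter ι} (hle : ∀ i, H i ≤ G)
    (hlim : ∀ x y, G.Adj x y → ∀ᶠ i in l, (H i).Adj x y) (v : V) (k : ℕ) :
    ∀ᶠ i in l, ¬ (((H i).connectedComponentMk v).supp.encard = k ∧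
      (G.connectedComponentMk v).supp ≠ ((H i).connectedComponentMk v).supp) := by
  have key : ∀ F : Set V, F.Finite → F ⊆ (G.connectedComponentMk v).supp →
      ∀ᶠ i in l, F ⊆ ((H i).connectedComponentMk v).supp := fun F hF hsub =>
    (hF.eventually_all).2 fun w hw => by
      have hw' := hsub hw
      rw [ConnectedComponent.mem_supp_iff, ConnectedComponent.eq] at hw'
      filter_upwards [eventually_reachable hlim hw'] with i hi
      rwa [ConnectedComponent.mem_supp_iff, ConnectedComponent.eq]
  by_cases hfin : (G.connectedComponentMk v).supp.Finite
  · filter_upwards [key _ hfin subset_rfl] with i hi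
    refine fun h => h.2 (hi.antisymm fun w hw => ?_)
    rw [ConnectedComponent.mem_supp_iff, ConnectedComponent.eq] at hw ⊢
    exact hw.mono (hle i)
  -- Capturing `k + 1` vertices already rules out a component of size `k`.
  · obtain ⟨F, hF, hcard⟩ := Set.Infinite.exists_subset_card_eq hfin (k + 1)
    filter_upwards [key F F.finite_toSet hF] with i hi
    intro h
    have := Set.encard_le_encard hi
    rw [h.1, Set.encard_coe_eq_coe_finsetCard, hcard, Nat.cast_le] at this
    omega

/-- Split by walk length and, inductively, by the penultimate vertex; countability of `V` keeps the
unions countable. -/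
theorem measurableSet_reachable {V Ω : Type*} [Countable V] [MeasurableSpace Ω]
    {H : Ω → SimpleGraph V} (hH : ∀ x y, MeasurableSet {ω | (H ω).Adj x y}) (v w : V) :
    MeasurableSet {ω | (H ω).Reachable v w} := by
  have hwalk : ∀ (n : ℕ) (w : V),
      MeasurableSet {ω | ∃ p : (H ω).Walk v w, p.length = n} := by
    intro n
    induction n with
    | zero =>
      intro w
      by_cases h : v = w
      · subst h
        convert MeasurableSet.univ
        exact Set.eq_univ_of_forall fun ω => ⟨Walk.nil, rfl⟩
      · convert MeasurableSet.empty
        exact Set.eq_empty_of_forall_notMem fun ω ⟨p, hp⟩ => h (Walk.eq_of_length_eq_zero hp)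
    | succ n ih =>
      intro w
      have : {ω | ∃ p : (H ω).Walk v w, p.length = n + 1} =
          ⋃ x, {ω | ∃ p : (H ω).Walk v x, p.length = n} ∩ {ω | (H ω).Adj x w} := by
        ext ω
        simp only [Set.mem_ofPred_eq, Set.mem_iUnion, Set.mem_inter_iff]
        constructor
        · rintro ⟨p, hp⟩
          have hnil : ¬ p.Nil := by
            rw [← Walk.length_eq_zero_iff]; omega
          refine ⟨p.penultimate, ⟨p.dropLast, ?_⟩, p.adj_penultimate hnil⟩
          rw [Walk.length_dropLast]; omega
        · rintro ⟨x, ⟨p, hp⟩, h⟩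
          exact ⟨p.concat h, by rw [Walk.length_concat, hp]⟩
      rw [this]
      exact MeasurableSet.iUnion fun x => (ih x).inter (hH x w)
  have : {ω | (H ω).Reachable v w} = ⋃ n, {ω | ∃ p : (H ω).Walk v w, p.length = n} := by
    ext ω
    simp only [Set.mem_ofPred_eq, Set.mem_iUnion]
    exact ⟨fun ⟨p⟩ => ⟨_, p, rfl⟩, fun ⟨_, p, _⟩ => ⟨p⟩⟩
  rw [this]
  exact MeasurableSet.iUnion fun n => hwalk n w

theorem measurable_supp {V Ω : Type*} [Countable V] [MeasurableSpace Ω]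
    {H : Ω → SimpleGraph V} (hH : ∀ x y, MeasurableSet {ω | (H ω).Adj x y}) (v : V) :
    Measurable fun ω => ((H ω).connectedComponentMk v).supp := by
  refine measurable_set_iff.2 fun w => measurableSet_setOfPred.1 ?_
  simp only [ConnectedComponent.mem_supp_iff, ConnectedComponent.eq]
  exact measurableSet_reachable hH w v

end SimpleGraph

/-! ### Connection functions and the labelled graph -/

namespace ConnectionFunction

variable {d : ℕ}

/-- A radial function is its profile along a unit vector composed with the norm, and a monotone
profile is Borel. Clamping at `0` makes the profile antitone on all of `ℝ`. -/
theorem measurable_toFun (hd : 1 ≤ d) (g : ConnectionFunction d) : Measurable g.toFun := by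
  have : Nonempty (Fin d) := ⟨⟨0, hd⟩⟩
  obtain ⟨e, he⟩ := exists_norm_eq (EuclideanSpace ℝ (Fin d)) zero_le_one
  have hnorm : ∀ r : ℝ, ‖max r 0 • e‖ = max r 0 := fun r => by
    rw [norm_smul, he, mul_one, Real.norm_of_nonneg (le_max_right _ _)]
  have hanti : Antitone fun r : ℝ => g.toFun (max r 0 • e) := fun r s h =>
    g.antitone _ _ (by rw [hnorm, hnorm]; exact max_le_max_right 0 h)
  have hg : g.toFun = (fun r : ℝ => g.toFun (max r 0 • e)) ∘ norm := by
    funext x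
    exact g.radial _ _ (by rw [hnorm, max_eq_left (norm_nonneg x)])
  rw [hg]
  exact hanti.measurable.comp measurable_norm

theorem cutoff_le (g : ConnectionFunction d) (R : ℝ) (x : EuclideanSpace ℝ (Fin d)) :
    (g.cutoff R).toFun x ≤ g.toFun x := by
  by_cases h : ‖x‖ ≤ R
  · exact (if_pos h).le
  · exact (if_neg h).trans_le (g.nonneg x)

theorem cutoff_eq (g : ConnectionFunction d) {R : ℝ} {x : EuclideanSpace ℝ (Fin d)}
    (h : ‖x‖ ≤ R) : (g.cutoff R).toFun x = g.toFun x :=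
  if_pos h

/-- The random connection graph on a set `V` of labels, where the label `i` stands for the point
`φ i` and the mark of the pair of labels `e` is `v e`. -/
def labelGraph {V : Type*} (g : ConnectionFunction d) (φ : V → EuclideanSpace ℝ (Fin d))
    (v : {e : Sym2 V // ¬ e.IsDiag} → ℝ) : SimpleGraph V where
  Adj i j := ∃ h : i ≠ j, v ⟨s(i, j), h⟩ ≤ g.toFun (φ i - φ j)
  symm := ⟨fun i j ⟨h, hv⟩ => ⟨h.symm, by
    simpa only [Sym2.eq_swap (a := j), g.radial _ _ (norm_sub_rev (φ j) (φ i))] using hv⟩⟩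
  loopless := ⟨fun _ ⟨h, _⟩ => h rfl⟩

/-- An injective enumeration of the vertices identifies the labelled graph with the graph. -/
noncomputable def labelGraphIso {V : Type*} (g : ConnectionFunction d)
    {φ : V → EuclideanSpace ℝ (Fin d)} (hφ : Function.Injective φ)
    {S : Set (EuclideanSpace ℝ (Fin d))} (hS : Set.range φ = S)
    {u : Sym2 (EuclideanSpace ℝ (Fin d)) → ℝ} {v : {e : Sym2 V // ¬ e.IsDiag} → ℝ}
    (huv : ∀ e, v e = u (e.1.map φ)) : g.labelGraph φ v ≃g g.graph S u where
  toEquiv := (Equiv.ofInjective φ hφ).trans (Equiv.setCongr hS)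
  map_rel_iff' {i j} := by
    have hne : (((Equiv.ofInjective φ hφ).trans (Equiv.setCongr hS)) i ≠
        ((Equiv.ofInjective φ hφ).trans (Equiv.setCongr hS)) j) ↔ i ≠ j :=
      (Equiv.injective _).ne_iff
    simp only [graph, labelGraph, huv, hne, exists_prop]
    rfl

/-- The bijection does not depend on `g`, so sizes and equality of the clusters of `g` and of its
cutoff can be compared on labels. -/
theorem originCluster_eq_image_supp {V : Type*} (g : ConnectionFunction d)
    {φ : V → EuclideanSpace ℝ (Fin d)} (hφ : Function.Injective φ)
    {S : Set (EuclideanSpace ℝ (Fin d))} (hS : Set.range φ = insert 0 S)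
    {u : Sym2 (EuclideanSpace ℝ (Fin d)) → ℝ} {v : {e : Sym2 V // ¬ e.IsDiag} → ℝ}
    (huv : ∀ e, v e = u (e.1.map φ)) {o : V} (ho : φ o = 0) :
    g.originCluster S u = ((Equiv.ofInjective φ hφ).trans (Equiv.setCongr hS)) ''
      ((g.labelGraph φ v).connectedComponentMk o).supp := by
  have h0 : g.labelGraphIso hφ hS huv o = ⟨0, Set.mem_insert 0 S⟩ := Subtype.ext ho
  rw [Equiv.image_eq_preimage_symm]
  ext x
  obtain ⟨i, rfl⟩ := (g.labelGraphIso hφ hS huv).surjective x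
  have hi : ((Equiv.ofInjective φ hφ).trans (Equiv.setCongr hS)).symm
      (g.labelGraphIso hφ hS huv i) = i := Equiv.symm_apply_apply _ i
  rw [Set.mem_preimage, hi, originCluster, ← h0, SimpleGraph.ConnectedComponent.mem_supp_iff,
    SimpleGraph.ConnectedComponent.mem_supp_iff, SimpleGraph.ConnectedComponent.eq,
    SimpleGraph.ConnectedComponent.eq, SimpleGraph.Iso.reachable_iff]

theorem cutoff_labelGraph_le {V : Type*} (g : ConnectionFunction d) (R : ℝ)
    (φ : V → EuclideanSpace ℝ (Fin d)) (v : {e : Sym2 V // ¬ e.IsDiag} → ℝ) :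
    (g.cutoff R).labelGraph φ v ≤ g.labelGraph φ v :=
  fun _ _ ⟨h, hv⟩ => ⟨h, hv.trans (g.cutoff_le R _)⟩

theorem eventually_cutoff_labelGraph_adj {V : Type*} (g : ConnectionFunction d)
    (φ : V → EuclideanSpace ℝ (Fin d)) (v : {e : Sym2 V // ¬ e.IsDiag} → ℝ) (i j : V)
    (h : (g.labelGraph φ v).Adj i j) :
    ∀ᶠ R in atTop, ((g.cutoff R).labelGraph φ v).Adj i j := by
  filter_upwards [eventually_ge_atTop ‖φ i - φ j‖] with R hR
  obtain ⟨hij, hv⟩ := h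
  exact ⟨hij, hv.trans_eq (g.cutoff_eq hR).symm⟩

theorem measurableSet_labelGraph_adj {V Ω : Type*} [MeasurableSpace Ω] (hd : 1 ≤ d)
    (g : ConnectionFunction d) {φ : Ω → V → EuclideanSpace ℝ (Fin d)}
    (hφ : ∀ i, Measurable fun ω => φ ω i) {v : Ω → {e : Sym2 V // ¬ e.IsDiag} → ℝ}
    (hv : ∀ e, Measurable fun ω => v ω e) (i j : V) :
    MeasurableSet {ω | (g.labelGraph (φ ω) (v ω)).Adj i j} := by
  by_cases hij : i = j
  · subst hij
    simp
  · have : {ω | (g.labelGraph (φ ω) (v ω)).Adj i j} =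
        {ω | v ω ⟨s(i, j), hij⟩ ≤ g.toFun (φ ω i - φ ω j)} := by
      ext ω
      exact ⟨fun ⟨_, h⟩ => h, fun h => ⟨hij, h⟩⟩
    rw [this]
    exact measurableSet_le (hv _) ((g.measurable_toFun hd).comp ((hφ i).sub (hφ j)))

end ConnectionFunction

/-! ### The Poisson process and its enumeration -/

/-- A point has volume zero when `d ≥ 1`, so its count is Poisson of mean `0`. At the origin, this
makes `withOrigin` injective almost surely. -/
theorem IsPoissonPointProcess.ae_notMem {d : ℕ} (hd : 1 ≤ d) {Ω : Type*} [MeasurableSpace Ω]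
    {P : Measure Ω} {lam : ℝ≥0} {η : Ω → Set (EuclideanSpace ℝ (Fin d))}
    (h : IsPoissonPointProcess P lam η) (x : EuclideanSpace ℝ (Fin d)) : ∀ᵐ ω ∂P, x ∉ η ω := by
  have : Nonempty (Fin d) := ⟨⟨0, hd⟩⟩
  have hvol : volume ({x} : Set (EuclideanSpace ℝ (Fin d))) = 0 := measure_singleton x
  have hlaw := h.hasLaw_count {x} (measurableSet_singleton x) (by simp [hvol])
  have hae : ∀ᵐ n ∂(poissonMeasure (lam * (volume {x}).toNNReal)).map (Nat.cast : ℕ → ℕ∞),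
      n = 0 := by
    have hcast : AEMeasurable (Nat.cast : ℕ → ℕ∞)
        (poissonMeasure (lam * (volume ({x} : Set (EuclideanSpace ℝ (Fin d)))).toNNReal)) :=
      Measurable.of_discrete.aemeasurable
    refine (ae_map_iff hcast (measurableSet_singleton (0 : ℕ∞))).2 (ae_iff_of_countable.2 ?_)
    intro n hn
    by_contra hne
    refine hn ?_
    rw [poissonMeasure_singleton]
    simp [hvol, Nat.cast_ne_zero.1 hne]
  have hae' := (hlaw.ae_iff (p := fun n => n = 0) (by fun_prop)).2 hae
  filter_upwards [hae'] with ω hω hx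
  rw [Set.encard_eq_zero] at hω
  exact Set.notMem_empty x (hω ▸ ⟨hx, rfl⟩)

theorem withOrigin_injective {d : ℕ} {x : ℕ → EuclideanSpace ℝ (Fin d)}
    (hx : Function.Injective x) (h0 : 0 ∉ Set.range x) : Function.Injective (withOrigin x)
  | none, none, _ => rfl
  | none, some j, h => (h0 ⟨j, h.symm⟩).elim
  | some i, none, h => (h0 ⟨i, h⟩).elim
  | some _, some _, h => congrArg some (hx h)

theorem range_withOrigin {d : ℕ} (x : ℕ → EuclideanSpace ℝ (Fin d)) :
    Set.range (withOrigin x) = insert 0 (Set.range x) := by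
  ext y
  simp [Option.exists, withOrigin, eq_comm]

theorem measurable_withOrigin {d : ℕ} {Ω : Type*} [MeasurableSpace Ω]
    {X : Ω → ℕ → EuclideanSpace ℝ (Fin d)} (hX : Measurable X) :
    ∀ i, Measurable fun ω => withOrigin (X ω) i
  | none => measurable_const
  | some i => (measurable_pi_apply i).comp hX

theorem mainTheorem4 {d : ℕ} (hd : 1 ≤ d) (g : ConnectionFunction d)
    (hg_pos : 0 < ∫⁻ x, ENNReal.ofReal (g.toFun x))
    (hg_fin : ∫⁻ x, ENNReal.ofReal (g.toFun x) < ∞)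
    (lam : ℝ≥0) (hlam : 0 < lam)
    {Ω : Type*} [MeasurableSpace Ω] (P : Measure Ω) [IsProbabilityMeasure P]
    (η : Ω → Set (EuclideanSpace ℝ (Fin d)))
    (U : Ω → Sym2 (EuclideanSpace ℝ (Fin d)) → ℝ)
    (hRCM : IsMarkedPoisson P lam η U) (k : ℕ) :
    Tendsto
      (fun R : ℝ => P {ω | ((g.cutoff R).originCluster (η ω) (U ω)).encard = k ∧
        g.originCluster (η ω) (U ω) ≠ (g.cutoff R).originCluster (η ω) (U ω)})
      atTop (𝓝 0) := by
  obtain ⟨X, hX, henum, hlaw, -, -⟩ := hRCM.marks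
  -- `HasLaw` gives only a.e. measurable marks; `v` takes measurable versions, which agree with the
  -- marks for all of the countably many pairs at once, almost surely.
  set v : Ω → {e : Sym2 (Option ℕ) // ¬ e.IsDiag} → ℝ :=
    fun ω e => (hlaw e).aemeasurable.mk _ ω
  have hv : ∀ e, Measurable fun ω => v ω e := fun e => (hlaw e).aemeasurable.measurable_mk
  have hvU : ∀ᵐ ω ∂P, ∀ e, v ω e = U ω (e.1.map (withOrigin (X ω))) :=
    ae_all_iff.2 fun e => (hlaw e).aemeasurable.ae_eq_mk.symm
  have hadj : ∀ f : ConnectionFunction d, ∀ i j,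
      MeasurableSet {ω | (f.labelGraph (withOrigin (X ω)) (v ω)).Adj i j} := fun f =>
    f.measurableSet_labelGraph_adj hd (measurable_withOrigin hX) hv
  set K : ConnectionFunction d → Ω → Set (Option ℕ) := fun f ω =>
    ((f.labelGraph (withOrigin (X ω)) (v ω)).connectedComponentMk none).supp
  have hK : ∀ f, Measurable (K f) := fun f => SimpleGraph.measurable_supp (hadj f) none
  set A : ℝ → Set Ω := fun R => {ω | (K (g.cutoff R) ω).encard = k ∧
    K g ω ≠ K (g.cutoff R) ω}
  have hA : ∀ R, MeasurableSet (A R) := by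
    intro R
    have hne : {ω | K g ω ≠ K (g.cutoff R) ω} =
        ⋃ i, {ω | ¬ (i ∈ K g ω ↔ i ∈ K (g.cutoff R) ω)} := by
      ext ω
      simp [Set.ext_iff]
    have hmeas : MeasurableSet {ω | K g ω ≠ K (g.cutoff R) ω} := by
      rw [hne]
      exact MeasurableSet.iUnion fun i => measurableSet_setOfPred.2
        ((measurable_set_iff.1 (hK g) i).iff (measurable_set_iff.1 (hK _) i)).not
    exact (measurable_encard.comp (hK _) (measurableSet_singleton (k : ℕ∞))).inter hmeas
  have hlim : Tendsto (fun R => P (A R)) atTop (𝓝 (P ∅)) := by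
    refine tendsto_measure_of_ae_tendsto_indicator_of_isFiniteMeasure atTop MeasurableSet.empty hA
      (Eventually.of_forall fun ω => ?_)
    filter_upwards [SimpleGraph.eventually_not_encard_supp_eq_and_ne
      (fun R => g.cutoff_labelGraph_le R (withOrigin (X ω)) (v ω))
      (g.eventually_cutoff_labelGraph_adj (withOrigin (X ω)) (v ω)) none k] with R hR
    exact iff_of_false hR (Set.notMem_empty ω)
  rw [measure_empty] at hlim
  -- The original event need not be measurable; it agrees with `A R` up to a null set, which
  -- suffices.
  refine hlim.congr fun R => measure_congr ?_
  filter_upwards [hvU, henum, hRCM.poisson.ae_notMem hd 0] with ω hω henumω h0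
  have hinj : Function.Injective (withOrigin (X ω)) :=
    withOrigin_injective henumω.1 (henumω.2 ▸ h0)
  have hrange : Set.range (withOrigin (X ω)) = insert 0 (η ω) := by
    rw [range_withOrigin, henumω.2]
  have hcluster := fun f : ConnectionFunction d =>
    f.originCluster_eq_image_supp hinj hrange hω (o := none) rfl
  refine propext ?_
  change (_ ∧ _) ↔ (_ ∧ _)
  rw [hcluster g, hcluster (g.cutoff R), (Equiv.injective _).encard_image,
    ((Equiv.injective _).image_injective).ne_iff]
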